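/- Let $\mathbb R^n$ carry its Euclidean inner product and norm. For $f:\mathbb R^n\to[-\infty,+\infty]$ put $\operatorname{dom} f=\{x: f(x)<+\infty\}$ and $f^*(y)=\sup_{x}(\langle y,x\rangle-f(x))$; let $\Gamma_0(\mathbb R^n)$ be the set of proper lower semicontinuous convex functions $\mathbb R^n\to\,]-\infty,+\infty]$. **Assumptions on $\phi$.** Let $\phi\in\Gamma_0(\mathbb R^n)$ be of Legendre type, i.e. essentially smooth ($U:=\operatorname{int}\operatorname{dom}\phi\ne\varnothing$, $\phi$ is differentiable on $U$, and $\|\nabla\phi(u_k)\|\to+\infty$ whenever $(u_k)\subset U$ converges to a boundary point of $U$) and essentially strictly convex (strictly convex on every convex subset of $\operatorname{dom}\partial\phi$), and $1$-coercive, i.e. $\phi(x)/\|x\|\to+\infty$ as $\|x\|\to+\infty$. Suppose that $\operatorname{dom}\phi$ is closed, that $\phi$ is continuous relative to $\operatorname{dom}\phi$, and that $\phi$ is twice continuously differentiable on $U$ with positive definite Hessian at every point of $U$. **Bregman notions.** Let $D_\phi(x,y)=\phi(x)-\phi(y)-\langle\nabla\phi(y),x-y\rangle$ if $y\in U$, and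 $D_\phi(x,y)=+\infty$ otherwise. For $f:\mathbb R^n\to\,]-\infty,+\infty]$ and $\lambda>0$ let $$\operatorname{env}^\phi_\lambda f(y)=\inf_{x\in\mathbb R^n}\Big(f(x)+\tfrac1\lambda D_\phi(x,y)\Big).$$ The function $f$ is $\phi$-prox-bounded if $\operatorname{env}^\phi_\lambda f(y)>-\infty$ for some $\lambda>0$ and some $y\in U$; its threshold $\lambda_f\in\,]0,+\infty]$ is the supremum of all such $\lambda$. The $\lambda$-$\phi$-proximal hull $\operatorname{hul}^\phi_\lambda f$ is the pointwise supremum of all functions $x\mapsto c-\frac1\lambda D_\phi(x,w)$ with $c\in\mathbb R$, $w\in U$, that are majorized by $f$. **Assumptions on $f_1,f_2,\lambda$.** Let $f_1,f_2:\mathbb R^n\to\,]-\infty,+\infty]$ be proper, lower semicontinuous and $\phi$-prox-bounded, with $\operatorname{dom} f_i\cap\operatorname{dom}\phi\neq\varnothing$ for $i=1,2$, and let $0<\lambda<\min\{\lambda_{f_1},\lambda_{f_2}\}$. For $\alpha\in[0,1]$ define the Bregman proximal average $$\mathcal P^\phi_\lambda(f_1,f_2,\alpha)=\Big[\alpha\big(f_1+\tfrac1\lambda\phi\big)^*+(1-\alpha)\big(f_2+\tfrac1\lambda\phi\big)^*\Big]^*-\tfrac1\lambda\phi,$$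 with the convention $+\infty-(+\infty)=+\infty$. **Epi-convergence.** A sequence $(g_k)$ epi-converges to $g$ at $x$ if $g(x)\le\liminf_k g_k(x_k)$ for every sequence $x_k\to x$, and $g(x)=\lim_k g_k(x_k)$ for some sequence $x_k\to x$; it epi-converges on $U$ if it does so at every $x\in U$. For a family indexed by $\alpha$, epi-convergence as $\alpha\downarrow0$ (resp. $\alpha\uparrow1$) means epi-convergence along every sequence of parameters $\alpha_k\to0$ with $\alpha_k>0$ (resp. $\alpha_k\to1$ with $\alpha_k<1$). **Theorem.** 1. As $\alpha\downarrow0$, $\mathcal P^\phi_\lambda(f_1,f_2,\alpha)$ epi-converges to $\operatorname{hul}^\phi_\lambda f_2$ on $U$. 2. As $\alpha\uparrow1$, $\mathcal P^\phi_\lambda(f_1,f_2,\alpha)$ epi-converges to $\operatorname{hul}^\phi_\lambda f_1$ on $U$. In particular, if $f_1,f_2\in\Gamma_0(\mathbb R^n)$, then (a) as $\alpha\downarrow0$, $\mathcal P^\phi_\lambda(f_1,f_2,\alpha)$ epi-converges to $f_2$ on $U$; (b) as $\alpha\uparrow1$, $\mathcal P^\phi_\lambda(f_1,f_2,\alpha)$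 epi-converges to $f_1$ on $U$. -/

import Mathlib

open Filter Topology Set

noncomputable section

namespace BregmanAverage

variable {n : ℕ}

/-- The Euclidean space `ℝⁿ`. -/
abbrev Rn (n : ℕ) : Type := EuclideanSpace ℝ (Fin n)

/-! ### Extended-real-valued functions -/

/-- The effective domain `{x | f x < +∞}`. -/
def effDom (f : Rn n → EReal) : Set (Rn n) := {x | f x < ⊤}

/-- A proper function: it never takes the value `-∞` and is not identically `+∞`. -/
def IsProper (f : Rn n → EReal) : Prop :=
  (∀ x, f x ≠ ⊥) ∧ (effDom f).Nonempty

/-- The class `Γ₀(ℝⁿ)` of proper lower semicontinuous convex functions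
(convexity means convexity of the epigraph). -/
def IsGammaZero (f : Rn n → EReal) : Prop :=
  IsProper f ∧ LowerSemicontinuous f ∧ Convex ℝ {p : Rn n × ℝ | f p.1 ≤ (p.2 : EReal)}

/-- The Fenchel conjugate `f*(y) = sup_x (⟨y, x⟩ - f x)`. -/
def fenchelConj (f : Rn n → EReal) (y : Rn n) : EReal :=
  ⨆ x : Rn n, ((inner ℝ y x : ℝ) : EReal) - f x

/-- Subtraction with the convention `+∞ - b = +∞` for every `b`, in particular
`+∞ - (+∞) = +∞` (in `EReal`, `⊤ - ⊤ = ⊥`). -/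
def subTop (a b : EReal) : EReal := if a = ⊤ then ⊤ else a - b

/-! ### Legendre functions -/

/-- `U = int dom φ`. -/
def intDom (φ : Rn n → EReal) : Set (Rn n) := interior (effDom φ)

/-- The real-valued version of `φ`; it is only used at points where `φ` is finite. -/
def realValued (φ : Rn n → EReal) (x : Rn n) : ℝ := (φ x).toReal

/-- The gradient of `φ`; it is only used at points of `int dom φ`. -/
def grad (φ : Rn n → EReal) (x : Rn n) : Rn n := gradient (realValued φ) x

/-- The domain of the convex subdifferential of `φ`: the points at which `φ` has a
subgradient. -/
def domSubdiff (φ : Rn n → EReal) : Set (Rn n) :=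
  {x | ∃ v : Rn n, ∀ y, φ x + ((inner ℝ v (y - x) : ℝ) : EReal) ≤ φ y}

/-- Essential smoothness: `int dom φ` is nonempty, `φ` is differentiable on it, and the norm
of the gradient blows up along sequences that converge to a boundary point of it. -/
def EssentiallySmooth (φ : Rn n → EReal) : Prop :=
  (intDom φ).Nonempty ∧
  (∀ x ∈ intDom φ, DifferentiableAt ℝ (realValued φ) x) ∧
  ∀ (u : ℕ → Rn n) (x : Rn n), (∀ k, u k ∈ intDom φ) → x ∈ frontier (intDom φ) →
    Tendsto u atTop (𝓝 x) → Tendsto (fun k => ‖grad φ (u k)‖) atTop atTop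

/-- Essential strict convexity: strict convexity on every convex subset of `dom ∂φ`. -/
def EssentiallyStrictlyConvex (φ : Rn n → EReal) : Prop :=
  ∀ C ⊆ domSubdiff φ, Convex ℝ C → StrictConvexOn ℝ C (realValued φ)

/-- Functions of Legendre type in `Γ₀(ℝⁿ)`. -/
def IsLegendre (φ : Rn n → EReal) : Prop :=
  IsGammaZero φ ∧ EssentiallySmooth φ ∧ EssentiallyStrictlyConvex φ

/-- `1`-coercivity: `φ x / ‖x‖ → +∞` as `‖x‖ → +∞`. -/
def OneCoercive (φ : Rn n → EReal) : Prop :=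
  Tendsto (fun x => φ x / ((‖x‖ : ℝ) : EReal)) (Bornology.cobounded (Rn n)) (𝓝 ⊤)

/-- `dom φ` is closed, `φ` is continuous relative to `dom φ`, and `φ` is twice continuously
differentiable on `int dom φ` with positive definite Hessian. -/
def IsRegularKernel (φ : Rn n → EReal) : Prop :=
  IsClosed (effDom φ) ∧ ContinuousOn φ (effDom φ) ∧
  ContDiffOn ℝ 2 (realValued φ) (intDom φ) ∧
  ∀ u ∈ intDom φ, ∀ v : Rn n, v ≠ 0 → 0 < inner ℝ (fderiv ℝ (grad φ) u v) v

/-! ### Bregman distance, envelope, prox-boundedness, proximal hull, proximal average -/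

open Classical in
/-- The Bregman distance `D_φ(x, y)`. -/
def bregDist (φ : Rn n → EReal) (x y : Rn n) : EReal :=
  if y ∈ intDom φ then φ x - φ y - ((inner ℝ (grad φ y) (x - y) : ℝ) : EReal) else ⊤

/-- The left Bregman envelope of `f` with parameter `lam`. -/
def leftEnv (φ f : Rn n → EReal) (lam : ℝ) (y : Rn n) : EReal :=
  ⨅ x : Rn n, f x + ((1 / lam : ℝ) : EReal) * bregDist φ x y

/-- The set of parameters `lam > 0` at which the envelope exceeds `-∞` somewhere on
`int dom φ` (outside `int dom φ` the envelope is `+∞` by definition). -/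
def proxParams (φ f : Rn n → EReal) : Set ℝ :=
  {lam | 0 < lam ∧ ∃ y ∈ intDom φ, ⊥ < leftEnv φ f lam y}

/-- `φ`-prox-boundedness. -/
def ProxBounded (φ f : Rn n → EReal) : Prop := (proxParams φ f).Nonempty

/-- The threshold of `φ`-prox-boundedness, possibly `+∞`. -/
def proxThreshold (φ f : Rn n → EReal) : EReal :=
  sSup ((fun lam : ℝ => (lam : EReal)) '' proxParams φ f)

/-- The `lam`-`φ`-proximal hull of `f`: the pointwise supremum of the functions
`x ↦ c - (1 / lam) D_φ(x, w)`, `c ∈ ℝ`, `w ∈ int dom φ`, that are majorized by `f`. -/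
def proxHull (φ f : Rn n → EReal) (lam : ℝ) (x : Rn n) : EReal :=
  sSup {t : EReal | ∃ (c : ℝ) (w : Rn n), w ∈ intDom φ ∧
    (∀ z, (c : EReal) - ((1 / lam : ℝ) : EReal) * bregDist φ z w ≤ f z) ∧
    t = (c : EReal) - ((1 / lam : ℝ) : EReal) * bregDist φ x w}

/-- The function `f + (1 / lam) φ`. -/
def addKernel (φ f : Rn n → EReal) (lam : ℝ) (x : Rn n) : EReal :=
  f x + ((1 / lam : ℝ) : EReal) * φ x

/-- The `α`-weighted Bregman proximal average of `f₁` and `f₂` with parameter `lam`. -/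
def proxAverage (φ f₁ f₂ : Rn n → EReal) (lam α : ℝ) (x : Rn n) : EReal :=
  subTop
    (fenchelConj (fun y => (α : EReal) * fenchelConj (addKernel φ f₁ lam) y
      + ((1 - α : ℝ) : EReal) * fenchelConj (addKernel φ f₂ lam) y) x)
    (((1 / lam : ℝ) : EReal) * φ x)

/-! ### Epi-convergence -/

/-- Epi-convergence of the sequence `F k` to `f` at the point `x`. -/
def EpiConvergesAt (F : ℕ → Rn n → EReal) (f : Rn n → EReal) (x : Rn n) : Prop :=
  (∀ u : ℕ → Rn n, Tendsto u atTop (𝓝 x) → f x ≤ liminf (fun k => F k (u k)) atTop) ∧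
  ∃ u : ℕ → Rn n, Tendsto u atTop (𝓝 x) ∧ Tendsto (fun k => F k (u k)) atTop (𝓝 (f x))

/-- Epi-convergence on `C` of a family `F α` with a real parameter, as `α` tends to its limit
along the filter `l`: epi-convergence at every point of `C` along every sequence of
parameters that tends to the limit. -/
def EpiConvergesOn (F : ℝ → Rn n → EReal) (l : Filter ℝ) (f : Rn n → EReal)
    (C : Set (Rn n)) : Prop :=
  ∀ a : ℕ → ℝ, Tendsto a atTop l → ∀ x ∈ C, EpiConvergesAt (fun k => F (a k)) f x

end BregmanAverage

end

open Filter Topology Set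

noncomputable section

namespace BregmanAverage

variable {n : ℕ}

/-! ### Extended reals -/

/-! Near each point of `U` the kernel is finite and continuous, so adding or subtracting `φ / lam`
does not affect epi-convergence, and the problem becomes one about Fenchel conjugates. Let `Gᵢ` be
the conjugate of `fᵢ + φ / lam`. Below the prox-threshold this sum grows faster than any multiple of
the norm (`superLinear_addKernel`), so `Gᵢ` is finite everywhere and the average is `(α G₁ + (1 - α)
G₂)* - φ / lam` with no indeterminate sums inside.

As `α ↓ 0` these conjugates epi-converge to `G₂*` (`epiConvergesAt_fenchelConj_average`). The lower
bound holds because, for each fixed slope, the affine functions in the supremum converge. The upper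
bound is the inequality `(α G₁ + (1 - α) G₂)* (α x₁ + (1 - α) x) ≤ α G₁* x₁ + (1 - α) G₂* x` at any
`x₁` where `G₁*` is finite.

It remains to recognise `G₂* - φ / lam` as the proximal hull (`proxHull_eq`). On `dom φ`, a function
`c - D_φ(·, w) / lam` is an affine function of slope `∇φ(w) / lam` minus `φ / lam`, and every slope
occurs because `∇φ` maps `U` onto the whole space (`IsGammaZero.exists_grad_eq`). For `f₂` in `Γ₀`,
Fenchel–Moreau gives `G₂* = f₂ + φ / lam`. The limit `α ↑ 1` follows by exchanging the two
functions. -/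

lemma coe_mul_top {c : ℝ} (hc : 0 < c) : (c : EReal) * ⊤ = ⊤ :=
  EReal.coe_mul_top_of_pos hc

lemma coe_mul_ne_bot {c : ℝ} (hc : 0 < c) {a : EReal} (ha : a ≠ ⊥) : (c : EReal) * a ≠ ⊥ := by
  induction a with
  | bot => exact absurd rfl ha
  | coe r => exact_mod_cast EReal.coe_ne_bot (c * r)
  | top => simp [coe_mul_top hc]

lemma continuous_coe_mul {c : ℝ} (hc : 0 < c) : Continuous fun a : EReal => (c : EReal) * a := by
  have hc' : (c : EReal) ≠ 0 := by exact_mod_cast hc.ne'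
  refine continuous_iff_continuousAt.2 fun a => ?_
  exact (EReal.continuousAt_mul (p := ((c : EReal), a)) (Or.inl hc') (Or.inl hc')
    (Or.inl (EReal.coe_ne_bot c)) (Or.inl (EReal.coe_ne_top c))).comp
    (continuousAt_const.prodMk continuousAt_id)

lemma monotone_coe_mul {c : ℝ} (hc : 0 < c) : Monotone fun a : EReal => (c : EReal) * a :=
  fun _ _ h => mul_le_mul_of_nonneg_left h (by exact_mod_cast hc.le)

lemma subTop_coe (a : EReal) (r : ℝ) : subTop a r = a - r := by
  unfold subTop
  split_ifs with h
  · simp [h]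
  · rfl

/-! ### Fenchel conjugates -/

/-- A real number bounds the conjugate at `y` iff it provides an affine minorant of slope `y`. -/
lemma fenchelConj_le_coe_iff {g : Rn n → EReal} {y : Rn n} {c : ℝ} :
    fenchelConj g y ≤ c ↔ ∀ z, ((inner ℝ y z - c : ℝ) : EReal) ≤ g z := by
  refine iSup_le_iff.trans (forall_congr' fun z => ?_)
  induction g z with
  | bot => simpa [EReal.sub_bot] using EReal.coe_ne_bot (inner ℝ y z - c)
  | coe r => norm_cast; exact ⟨fun h => by linarith, fun h => by linarith⟩
  | top => simp

lemma fenchelConj_ne_bot {g : Rn n → EReal} (hg : (effDom g).Nonempty) (y : Rn n) :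
    fenchelConj g y ≠ ⊥ := by
  obtain ⟨z, hz⟩ := hg
  refine ne_bot_of_le_ne_bot ?_ (le_iSup (fun x => ((inner ℝ y x : ℝ) : EReal) - g x) z)
  have hz' : g z ≠ ⊤ := (show g z < ⊤ from hz).ne
  induction h : g z with
  | bot => simp [EReal.sub_bot]
  | coe r => exact_mod_cast EReal.coe_ne_bot (inner ℝ y z - r)
  | top => exact absurd h hz'

/-- Growth faster than any multiple of the norm, in the form of lower bounds. -/
def SuperLinear (g : Rn n → EReal) : Prop :=
  ∀ M : ℝ, ∃ C : ℝ, ∀ x, ((M * ‖x‖ - C : ℝ) : EReal) ≤ g x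

/-- By Cauchy–Schwarz, growth at rate `‖y‖` absorbs the linear form of slope `y`. Finiteness allows
conjugates to be averaged as real functions. -/
lemma SuperLinear.exists_fenchelConj_eq_coe {g : Rn n → EReal} (hg : SuperLinear g)
    (hne : (effDom g).Nonempty) : ∃ G : Rn n → ℝ, ∀ y, fenchelConj g y = G y := by
  refine ⟨fun y => (fenchelConj g y).toReal, fun y => ?_⟩
  obtain ⟨C, hC⟩ := hg ‖y‖
  have hle : fenchelConj g y ≤ (C : ℝ) := by
    refine fenchelConj_le_coe_iff.2 fun z => le_trans ?_ (hC z)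
    exact_mod_cast sub_le_sub_right (real_inner_le_norm y z) C
  exact (EReal.coe_toReal (hle.trans_lt (EReal.coe_lt_top C)).ne
    (fenchelConj_ne_bot hne y)).symm

lemma le_fenchelConj_coe (h : Rn n → ℝ) (x y : Rn n) :
    ((inner ℝ x y - h y : ℝ) : EReal) ≤ fenchelConj (fun y => (h y : EReal)) x :=
  le_iSup (fun y => ((inner ℝ x y - h y : ℝ) : EReal)) y

lemma fenchelConj_coe_ne_bot (h : Rn n → ℝ) (x : Rn n) :
    fenchelConj (fun y => (h y : EReal)) x ≠ ⊥ :=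
  ne_bot_of_le_ne_bot (EReal.coe_ne_bot _) (le_fenchelConj_coe h x 0)

/-- The biconjugate is a minorant. -/
lemma fenchelConj_coe_le {g : Rn n → EReal} {G : Rn n → ℝ}
    (hG : ∀ y, fenchelConj g y = G y) (x : Rn n) :
    fenchelConj (fun y => (G y : EReal)) x ≤ g x :=
  iSup_le fun y => by
    have := fenchelConj_le_coe_iff.1 (hG y).le x
    rwa [real_inner_comm] at this

/-- **Fenchel–Moreau theorem**, for functions with a finite conjugate. -/
theorem IsGammaZero.fenchelConj_fenchelConj {g : Rn n → EReal} (hg : IsGammaZero g)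
    {G : Rn n → ℝ} (hG : ∀ y, fenchelConj g y = G y) (x : Rn n) :
    fenchelConj (fun y => (G y : EReal)) x = g x := by
  refine le_antisymm (fenchelConj_coe_le hG x) (EReal.ge_of_forall_gt_iff_ge.1 fun r hr => ?_)
  obtain ⟨⟨hbot, z₀, hz₀⟩, hlsc, hconv⟩ := hg
  have hclosed : IsClosed {p : Rn n × ℝ | g p.1 ≤ (p.2 : EReal)} :=
    hlsc.isClosed_epigraph.preimage
      (continuous_fst.prodMk (continuous_coe_real_ereal.comp continuous_snd))
  -- Separate the point `(x, r)`, which lies strictly below the graph, from the closed convex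
  -- epigraph. The functional is then written as `⟨p, ·⟩ + σ ·`.
  obtain ⟨L, u, hLx, hL⟩ := geometric_hahn_banach_point_closed hconv hclosed
    (x := (x, r)) (by simpa using hr)
  set p : Rn n := (InnerProductSpace.toDual ℝ (Rn n)).symm
    (L.comp (ContinuousLinearMap.inl ℝ (Rn n) ℝ)) with hp
  set σ : ℝ := L (0, 1) with hσ
  have hLeq : ∀ (z : Rn n) (s : ℝ), L (z, s) = inner ℝ p z + s * σ := by
    intro z s
    have h1 : L (z, 0) = inner ℝ p z := by
      rw [hp, InnerProductSpace.toDual_symm_apply]; rfl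
    have h2 : ((z, s) : Rn n × ℝ) = (z, 0) + s • ((0, 1) : Rn n × ℝ) := by simp
    rw [h2, map_add, map_smul, h1, smul_eq_mul]
  rw [hLeq] at hLx
  have hepi : ∀ (z : Rn n) (s : ℝ), g z ≤ s → u < inner ℝ p z + s * σ := fun z s hs => by
    have := hL (z, s) hs
    rwa [hLeq] at this
  -- The epigraph is unbounded upwards over `z₀`, so a negative `σ` would push the functional below
  -- `u`.
  have hσ0 : 0 ≤ σ := by
    by_contra! hneg
    obtain ⟨s₀, hs₀⟩ : ∃ s₀ : ℝ, g z₀ ≤ s₀ :=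
      ⟨(g z₀).toReal, EReal.le_coe_toReal (show g z₀ < ⊤ from hz₀).ne⟩
    set s : ℝ := max s₀ ((inner ℝ p z₀ - u) / (-σ)) with hs
    have h1 := hepi z₀ s (hs₀.trans (by exact_mod_cast le_max_left _ _))
    have h2 : (inner ℝ p z₀ - u) / (-σ) ≤ s := le_max_right _ _
    rw [div_le_iff₀ (by linarith)] at h2
    linarith
  have hminor : ∀ (z : Rn n) (s : ℝ) (y : Rn n), g z ≤ s → inner ℝ y z - G y ≤ s := by
    intro z s y hs
    have := (fenchelConj_le_coe_iff.1 (hG y).le z).trans hs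
    exact_mod_cast this
  -- an affine minorant of `g` bounds the conjugate of `G` from below
  have key : ∀ (y : Rn n) (c : ℝ), (∀ (z : Rn n) (s : ℝ), g z ≤ s → inner ℝ y z - c ≤ s) →
      r ≤ inner ℝ y x - c → (r : EReal) ≤ fenchelConj (fun y => (G y : EReal)) x := by
    intro y c hc hr
    have h1 : G y ≤ c := by
      have : fenchelConj g y ≤ (c : ℝ) := by
        refine fenchelConj_le_coe_iff.2 fun z => ?_
        refine EReal.le_of_forall_lt_iff_le.1 fun s hs => ?_
        exact_mod_cast hc z s hs.le
      rw [hG] at this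
      exact_mod_cast this
    refine le_trans ?_ (le_fenchelConj_coe G x y)
    rw [real_inner_comm]
    exact_mod_cast (by linarith : r ≤ inner ℝ y x - G y)
  rcases hσ0.eq_or_lt with h0 | hpos
  · rw [← h0] at hLx
    simp only [← h0, mul_zero, add_zero] at hepi hLx
    -- Vertical hyperplane: `u - ⟨p, ·⟩` is negative on `dom g` and positive at `x`. Adding `k`
    -- times it to the affine minorant `-G 0` keeps a minorant, and this `k` raises its value at `x`
    -- to at least `r`.
    set k : ℝ := max 0 ((r + G 0) / (u - inner ℝ p x)) with hk
    have hk0 : 0 ≤ k := le_max_left _ _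
    have hk1 : (r + G 0) / (u - inner ℝ p x) ≤ k := le_max_right _ _
    rw [div_le_iff₀ (by linarith)] at hk1
    refine key (-k • p) (G 0 - k * u) (fun z s hs => ?_) ?_
    · have h1 := hepi z s hs
      have h2 := hminor z s 0 hs
      rw [inner_zero_left] at h2
      rw [inner_smul_left]
      simp only [conj_trivial]
      nlinarith [mul_le_mul_of_nonneg_left h1.le hk0]
    · rw [inner_smul_left]
      simp only [conj_trivial]
      linarith
  -- Non-vertical hyperplane: solving for the last coordinate gives the affine minorant `σ⁻¹ (u -
  -- ⟨p, ·⟩)`, which exceeds `r` at `x`.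
  · refine key (-σ⁻¹ • p) (-(σ⁻¹ * u)) (fun z s hs => ?_) ?_
    · have h1 := hepi z s hs
      have h2 := mul_lt_mul_of_pos_left h1 (inv_pos.2 hpos)
      rw [mul_add, mul_comm s, inv_mul_cancel_left₀ hpos.ne'] at h2
      rw [inner_smul_left]
      simp only [conj_trivial]
      linarith
    · have h2 := mul_lt_mul_of_pos_left hLx (inv_pos.2 hpos)
      rw [mul_add, mul_comm r, inv_mul_cancel_left₀ hpos.ne'] at h2
      rw [inner_smul_left]
      simp only [conj_trivial]
      linarith

/-! ### Convergence of conjugates of averages -/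

/-- For each slope, the bound is the convex combination of the Fenchel–Young inequalities at `x₁`
and `x₂`. It controls the recovery sequence below. -/
lemma fenchelConj_average_le (G₁ G₂ : Rn n → ℝ) {α : ℝ} (hα₀ : 0 ≤ α) (hα₁ : α ≤ 1)
    {x₁ x₂ : Rn n} {r₁ r₂ : ℝ}
    (h₁ : fenchelConj (fun y => (G₁ y : EReal)) x₁ ≤ r₁)
    (h₂ : fenchelConj (fun y => (G₂ y : EReal)) x₂ ≤ r₂) :
    fenchelConj (fun y => ((α * G₁ y + (1 - α) * G₂ y : ℝ) : EReal)) (α • x₁ + (1 - α) • x₂) ≤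
      ((α * r₁ + (1 - α) * r₂ : ℝ) : EReal) := by
  refine iSup_le fun y => ?_
  have e₁ : inner ℝ x₁ y - G₁ y ≤ r₁ := by exact_mod_cast (le_fenchelConj_coe G₁ x₁ y).trans h₁
  have e₂ : inner ℝ x₂ y - G₂ y ≤ r₂ := by exact_mod_cast (le_fenchelConj_coe G₂ x₂ y).trans h₂
  rw [inner_add_left, inner_smul_left, inner_smul_left]
  simp only [conj_trivial]
  norm_cast
  nlinarith [mul_le_mul_of_nonneg_left e₁ hα₀,
    mul_le_mul_of_nonneg_left e₂ (sub_nonneg.2 hα₁)]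

/-- The conjugates of `α G₁ + (1 - α) G₂` epi-converge to the conjugate of `G₂` as `α ↓ 0`. -/
theorem epiConvergesAt_fenchelConj_average (G₁ G₂ : Rn n → ℝ) {x₁ : Rn n} {r₁ : ℝ}
    (h₁ : fenchelConj (fun y => (G₁ y : EReal)) x₁ ≤ r₁) {a : ℕ → ℝ}
    (ha : Tendsto a atTop (𝓝[>] 0)) (x : Rn n) :
    EpiConvergesAt
      (fun k => fenchelConj (fun y => ((a k * G₁ y + (1 - a k) * G₂ y : ℝ) : EReal)))
      (fenchelConj (fun y => (G₂ y : EReal))) x := by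
  have ha0 : Tendsto a atTop (𝓝 0) := ha.mono_right nhdsWithin_le_nhds
  have lower : ∀ u : ℕ → Rn n, Tendsto u atTop (𝓝 x) →
      fenchelConj (fun y => (G₂ y : EReal)) x ≤ liminf (fun k =>
        fenchelConj (fun y => ((a k * G₁ y + (1 - a k) * G₂ y : ℝ) : EReal)) (u k)) atTop := by
    intro u hu
    refine iSup_le fun y => ?_
    have hlim : Tendsto (fun k => inner ℝ (u k) y - (a k * G₁ y + (1 - a k) * G₂ y)) atTop
        (𝓝 (inner ℝ x y - G₂ y)) := by
      have := (hu.inner (𝕜 := ℝ) (tendsto_const_nhds (x := y))).sub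
        ((ha0.mul_const (G₁ y)).add ((ha0.const_sub 1).mul_const (G₂ y)))
      simpa using this
    have hlim' := (EReal.tendsto_coe.2 hlim).liminf_eq
    calc ((inner ℝ x y : ℝ) : EReal) - (G₂ y : EReal)
        = ((inner ℝ x y - G₂ y : ℝ) : EReal) := (EReal.coe_sub _ _).symm
      _ = _ := hlim'.symm
      _ ≤ _ := liminf_le_liminf (Eventually.of_forall fun k => le_fenchelConj_coe
          (fun y => a k * G₁ y + (1 - a k) * G₂ y) (u k) y)
  refine ⟨lower, ?_⟩
  -- Where the limit is `⊤`, the lower bound alone forces convergence along the constant sequence.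
  by_cases htop : fenchelConj (fun y => (G₂ y : EReal)) x = ⊤
  · refine ⟨fun _ => x, tendsto_const_nhds, ?_⟩
    have := lower (fun _ => x) tendsto_const_nhds
    rw [htop] at this ⊢
    exact tendsto_of_le_liminf_of_limsup_le this le_top
  · obtain ⟨r, hr⟩ : ∃ r : ℝ, fenchelConj (fun y => (G₂ y : EReal)) x = r :=
      ⟨_, (EReal.coe_toReal htop (fenchelConj_coe_ne_bot G₂ x)).symm⟩
    have hu : Tendsto (fun k => a k • x₁ + (1 - a k) • x) atTop (𝓝 x) := by
      have := (ha0.smul_const x₁).add ((ha0.const_sub 1).smul_const x)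
      simpa using this
    -- The conjugate of `G₁` may be infinite at `x`, so the recovery sequence gives weight `a k` to
    -- a point where it is finite.
    refine ⟨fun k => a k • x₁ + (1 - a k) • x, hu, ?_⟩
    refine tendsto_of_le_liminf_of_limsup_le (lower _ hu) ?_
    have hlim : Tendsto (fun k => a k * r₁ + (1 - a k) * r) atTop (𝓝 r) := by
      have := (ha0.mul_const r₁).add ((ha0.const_sub 1).mul_const r)
      simpa using this
    have hev : ∀ᶠ k in atTop, 0 ≤ a k ∧ a k ≤ 1 := by
      filter_upwards [ha.eventually self_mem_nhdsWithin,
        ha0.eventually (ge_mem_nhds one_pos)] with k h h'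
      exact ⟨le_of_lt h, h'⟩
    rw [hr, ← (EReal.tendsto_coe.2 hlim).limsup_eq]
    refine limsup_le_limsup ?_
    filter_upwards [hev] with k hk
    exact fenchelConj_average_le G₁ G₂ hk.1 hk.2 h₁ hr.le

/-- Epi-convergence at `x` is kept when a function that is finite and continuous near `x` is
subtracted. -/
lemma EpiConvergesAt.subTop {F : ℕ → Rn n → EReal} {f ψ : Rn n → EReal} {p : Rn n → ℝ}
    {x : Rn n} (h : EpiConvergesAt F f x) (hψ : ∀ᶠ z in 𝓝 x, ψ z = p z)
    (hp : ContinuousAt p x) :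
    EpiConvergesAt (fun k z => subTop (F k z) (ψ z)) (fun z => subTop (f z) (ψ z)) x := by
  -- Near `x` the subtracted function is real, so the convention for `⊤ - ⊤` plays no role and the
  -- operation is addition of a convergent real sequence.
  have hev : ∀ u : ℕ → Rn n, Tendsto u atTop (𝓝 x) → ∀ᶠ k in atTop,
      F k (u k) + ((-p (u k) : ℝ) : EReal) = BregmanAverage.subTop (F k (u k)) (ψ (u k)) := by
    intro u hu
    filter_upwards [hu.eventually hψ] with k hk
    rw [hk, subTop_coe, EReal.coe_neg, sub_eq_add_neg]
  have hneg : ∀ u : ℕ → Rn n, Tendsto u atTop (𝓝 x) →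
      Tendsto (fun k => ((-p (u k) : ℝ) : EReal)) atTop (𝓝 ((-p x : ℝ) : EReal)) :=
    fun u hu => EReal.tendsto_coe.2 (hp.tendsto.comp hu).neg
  have hx : BregmanAverage.subTop (f x) (ψ x) = f x + ((-p x : ℝ) : EReal) := by
    rw [hψ.self_of_nhds, subTop_coe, EReal.coe_neg, sub_eq_add_neg]
  refine ⟨fun u hu => ?_, ?_⟩
  · dsimp only
    rw [hx, ← liminf_congr (hev u hu)]
    calc f x + ((-p x : ℝ) : EReal)
        ≤ liminf (fun k => F k (u k)) atTop
          + liminf (fun k => ((-p (u k) : ℝ) : EReal)) atTop :=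
          add_le_add (h.1 u hu) (hneg u hu).liminf_eq.ge
      _ ≤ _ := EReal.le_liminf_add
  · obtain ⟨u, hu, hF⟩ := h.2
    refine ⟨u, hu, ?_⟩
    dsimp only
    rw [hx]
    refine Tendsto.congr' (hev u hu) ?_
    exact (EReal.continuousAt_add (p := (f x, ((-p x : ℝ) : EReal)))
      (Or.inr (EReal.coe_ne_bot _)) (Or.inr (EReal.coe_ne_top _))).tendsto.comp
      (hF.prodMk_nhds (hneg u hu))

/-! ### Legendre kernels -/

lemma IsProper.coe_realValued {φ : Rn n → EReal} (hφ : IsProper φ) {z : Rn n}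
    (hz : z ∈ effDom φ) : φ z = realValued φ z :=
  (EReal.coe_toReal (show φ z < ⊤ from hz).ne (hφ.1 z)).symm

lemma IsGammaZero.convexOn_realValued {φ : Rn n → EReal} (hφ : IsGammaZero φ) :
    ConvexOn ℝ (effDom φ) (realValued φ) := by
  have key : ∀ ⦃x⦄, x ∈ effDom φ → ∀ ⦃y⦄, y ∈ effDom φ → ∀ ⦃a b : ℝ⦄, 0 ≤ a → 0 ≤ b →
      a + b = 1 → φ (a • x + b • y) ≤ ((a * realValued φ x + b * realValued φ y : ℝ) : EReal) :=
    fun x hx y hy a b ha hb hab =>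
      hφ.2.2 (x := (x, realValued φ x)) (hφ.1.coe_realValued hx).le
        (y := (y, realValued φ y)) (hφ.1.coe_realValued hy).le ha hb hab
  refine ⟨fun x hx y hy a b ha hb hab =>
    (key hx hy ha hb hab).trans_lt (EReal.coe_lt_top _), fun x hx y hy a b ha hb hab => ?_⟩
  have h := key hx hy ha hb hab
  rw [hφ.1.coe_realValued (h.trans_lt (EReal.coe_lt_top _))] at h
  exact_mod_cast h

lemma hasGradientAt_realValued {φ : Rn n → EReal} (hφ : EssentiallySmooth φ) {w : Rn n}
    (hw : w ∈ intDom φ) : HasGradientAt (realValued φ) (grad φ w) w :=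
  (hφ.2.1 w hw).hasGradientAt

/-- The gradient inequality. -/
lemma IsGammaZero.add_inner_grad_le {φ : Rn n → EReal} (hφ : IsGammaZero φ)
    (hs : EssentiallySmooth φ) {w z : Rn n} (hw : w ∈ intDom φ) (hz : z ∈ effDom φ) :
    realValued φ w + inner ℝ (grad φ w) (z - w) ≤ realValued φ z := by
  -- On the line from `w` to `z`, the chord slope over `[0, 1]` dominates the derivative at `0`.
  have hconv := hφ.convexOn_realValued.comp_affineMap (AffineMap.lineMap (k := ℝ) w z)
  have hder : HasDerivAt (realValued φ ∘ AffineMap.lineMap (k := ℝ) w z)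
      (inner ℝ (grad φ w) (z - w)) 0 := by
    have h1 : HasDerivAt (AffineMap.lineMap (k := ℝ) w z) (z - w) 0 := AffineMap.hasDerivAt_lineMap
    have h2 : HasFDerivAt (realValued φ) (InnerProductSpace.toDual ℝ (Rn n) (grad φ w))
        (AffineMap.lineMap (k := ℝ) w z 0) := by
      rw [AffineMap.lineMap_apply_zero]
      exact (hasGradientAt_realValued hs hw).hasFDerivAt
    exact h2.comp_hasDerivAt 0 h1
  have := hconv.le_slope_of_hasDerivAt (x := 0) (y := 1)
    (by simpa using interior_subset hw) (by simpa using hz) one_pos hder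
  simp only [slope, sub_zero, inv_one, Function.comp_apply, AffineMap.lineMap_apply_one,
    AffineMap.lineMap_apply_zero, vsub_eq_sub, one_smul] at this
  linarith

/-- Coercivity gives the bound outside a ball; inside, lower semicontinuity and compactness bound
`φ` from below. The constant is taken large enough for both regions. -/
lemma OneCoercive.superLinear {φ : Rn n → EReal} (hc : OneCoercive φ) (hφ : IsGammaZero φ) :
    SuperLinear φ := by
  intro M
  obtain ⟨R₀, -, hR₀⟩ := hasBasis_cobounded_norm.eventually_iff.1
    (EReal.tendsto_nhds_top_iff_real.1 hc M)
  set R := max R₀ 1 with hR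
  have hR1 : 1 ≤ R := le_max_right _ _
  obtain ⟨x₀, -, hmin⟩ := LowerSemicontinuousOn.exists_isMinOn
    (s := Metric.closedBall (0 : Rn n) R) ⟨0, by simp; linarith⟩
    (isCompact_closedBall _ _) (hφ.2.1.lowerSemicontinuousOn _)
  set c := (φ x₀).toReal with hcdef
  have hcle : (c : EReal) ≤ φ x₀ := EReal.coe_toReal_le (hφ.1.1 x₀)
  refine ⟨max 0 (|M| * R - c), fun x => ?_⟩
  rcases le_or_gt ‖x‖ R with hx | hx
  · refine le_trans ?_ (hcle.trans (hmin (by simpa using hx)))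
    have h1 : M * ‖x‖ ≤ |M| * R :=
      (mul_le_mul_of_nonneg_right (le_abs_self M) (norm_nonneg x)).trans
        (mul_le_mul_of_nonneg_left hx (abs_nonneg M))
    have h2 : |M| * R - c ≤ max 0 (|M| * R - c) := le_max_right _ _
    exact_mod_cast (by linarith : M * ‖x‖ - max 0 (|M| * R - c) ≤ c)
  · have hx0 : 0 < ‖x‖ := by linarith
    have h1 : (M : EReal) < φ x / ((‖x‖ : ℝ) : EReal) :=
      hR₀ (show R₀ ≤ ‖x‖ from (le_max_left _ _).trans hx.le)
    have h2 := (EReal.le_div_iff_mul_le (by exact_mod_cast hx0) (EReal.coe_ne_top _)).1 h1.le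
    refine le_trans ?_ h2
    exact_mod_cast sub_le_self (M * ‖x‖) (le_max_left 0 (|M| * R - c))

/-- Tilting by a linear form does not destroy coercivity, so the minimum over a large ball is
global. Its minimizer is the candidate for a point with gradient `v`. -/
lemma SuperLinear.exists_forall_sub_inner_le {φ : Rn n → EReal} (hc : SuperLinear φ)
    (hφ : IsProper φ) (hlsc : LowerSemicontinuous φ) (v : Rn n) :
    ∃ x₀ ∈ effDom φ, ∀ z ∈ effDom φ,
      realValued φ x₀ - inner ℝ v x₀ ≤ realValued φ z - inner ℝ v z := by
  obtain ⟨C, hC⟩ := hc (‖v‖ + 1)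
  obtain ⟨z₀, hz₀⟩ := hφ.2
  set ψ : Rn n → EReal := fun z => φ z + ((-inner ℝ v z : ℝ) : EReal) with hψ
  have hψlsc : LowerSemicontinuous ψ := by
    refine hlsc.add' (Continuous.lowerSemicontinuous ?_) fun x =>
      EReal.continuousAt_add (Or.inr (EReal.coe_ne_bot _)) (Or.inr (EReal.coe_ne_top _))
    exact continuous_coe_real_ereal.comp (by fun_prop)
  have hψval : ∀ z ∈ effDom φ, ψ z = ((realValued φ z - inner ℝ v z : ℝ) : EReal) := by
    intro z hz
    rw [hψ, sub_eq_add_neg, EReal.coe_add, ← hφ.coe_realValued hz]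
  set m := realValued φ z₀ - inner ℝ v z₀ with hm
  -- The ball contains `z₀`, and outside it the tilted function is at least `‖z‖ - C > m`, its value
  -- at `z₀`.
  set R := max ‖z₀‖ (m + C) with hR
  obtain ⟨x₀, -, hmin⟩ := LowerSemicontinuousOn.exists_isMinOn
    (s := Metric.closedBall (0 : Rn n) R)
    ⟨z₀, by simp [hR]⟩ (isCompact_closedBall _ _) (hψlsc.lowerSemicontinuousOn _)
  have hx₀m : ψ x₀ ≤ m := by
    rw [hm, ← hψval z₀ hz₀]
    exact hmin (show z₀ ∈ Metric.closedBall (0 : Rn n) R by simp [hR])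
  have hx₀ : x₀ ∈ effDom φ := by
    by_contra h
    have htop : φ x₀ = ⊤ := not_lt_top_iff.1 h
    rw [hψ] at hx₀m
    simp only [htop, EReal.top_add_coe] at hx₀m
    exact absurd hx₀m (not_le.2 (EReal.coe_lt_top m))
  refine ⟨x₀, hx₀, fun z hz => ?_⟩
  rcases le_or_gt ‖z‖ R with hzR | hzR
  · have : ψ x₀ ≤ ψ z := hmin (by simpa using hzR)
    rw [hψval z hz, hψval x₀ hx₀] at this
    exact_mod_cast this
  · rw [hψval x₀ hx₀] at hx₀m
    have h1 : realValued φ x₀ - inner ℝ v x₀ ≤ m := by exact_mod_cast hx₀m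
    have h2 := hC z
    rw [hφ.coe_realValued hz] at h2
    have h3 : (‖v‖ + 1) * ‖z‖ - C ≤ realValued φ z := by exact_mod_cast h2
    have h4 : m + C ≤ R := le_max_right _ _
    have h5 := real_inner_le_norm v z
    linarith

/-- An essentially smooth function has no subgradients at boundary points of its domain. -/
lemma IsGammaZero.mem_intDom_of_forall_sub_inner_le {φ : Rn n → EReal} (hφ : IsGammaZero φ)
    (hs : EssentiallySmooth φ) {v x₀ : Rn n} (hx₀ : x₀ ∈ effDom φ)
    (hmin : ∀ z ∈ effDom φ, realValued φ x₀ - inner ℝ v x₀ ≤ realValued φ z - inner ℝ v z) :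
    x₀ ∈ intDom φ := by
  by_contra hnot
  have hconv := hφ.convexOn_realValued
  obtain ⟨u, hu⟩ := hs.1
  set p : Rn n → ℝ := fun z => realValued φ z - inner ℝ v z with hp
  have hpconv : ConvexOn ℝ (effDom φ) p :=
    hconv.sub ((innerSL ℝ v).toLinearMap.concaveOn hconv.1)
  have hpcont : ContinuousAt p u :=
    (hs.2.1 u hu).continuousAt.sub (by fun_prop)
  obtain ⟨r, hr, hball⟩ : ∃ r > 0, ∀ z ∈ Metric.ball u r, z ∈ intDom φ ∧ p z < p u + 1 := by
    have h1 : ∀ᶠ z in 𝓝 u, z ∈ intDom φ ∧ p z < p u + 1 :=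
      (isOpen_interior.eventually_mem hu).and
        (hpcont.eventually (gt_mem_nhds (lt_add_one (p u))))
    exact Metric.eventually_nhds_iff_ball.1 h1
  set t : ℕ → ℝ := fun k => 1 / ((k : ℝ) + 1) with ht
  have ht0 : ∀ k, 0 < t k := fun k => Nat.one_div_pos_of_nat
  have ht1 : ∀ k, t k ≤ 1 := fun k => by
    rw [ht, div_le_one (by positivity)]; linarith [Nat.cast_nonneg (α := ℝ) k]
  have htlim : Tendsto t atTop (𝓝 0) := tendsto_one_div_add_atTop_nhds_zero_nat
  -- If the minimizer were a boundary point, gradients would blow up along this segment from the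
  -- interior point `u`; minimality will keep them bounded.
  set x : ℕ → Rn n := fun k => (1 - t k) • x₀ + t k • u with hxdef
  have hxmem : ∀ k, x k ∈ intDom φ := fun k =>
    hconv.1.combo_self_interior_mem_interior hx₀ hu (sub_nonneg.2 (ht1 k)) (ht0 k) (by ring)
  have hxlim : Tendsto x atTop (𝓝 x₀) := by
    have := ((htlim.const_sub 1).smul_const x₀).add (htlim.smul_const u)
    simpa using this
  have hfront : x₀ ∈ frontier (intDom φ) := by
    refine ⟨mem_closure_of_tendsto hxlim (Eventually.of_forall hxmem), ?_⟩
    rwa [intDom, interior_interior]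
  have hblow := hs.2.2 x x₀ hxmem hfront hxlim
  -- Move `u` to `u'` by `r / 2` in the direction of `w = ∇φ(x k) - v`, which shifts `x k` by `t k *
  -- (r / 2)` in that direction. Convexity of `p` bounds its value at the shifted point from above;
  -- the gradient inequality and minimality of `x₀` bound it from below. The factor `t k` cancels.
  have hbound : ∀ k, ‖grad φ (x k)‖ ≤ ‖v‖ + 2 * (p u + 1 - p x₀) / r := by
    intro k
    set w := grad φ (x k) - v with hw
    -- If `w = 0` then `e = 0`, and both facts below about `e` still hold.
    set e : Rn n := ‖w‖⁻¹ • w with he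
    have henorm : ‖e‖ ≤ 1 := by
      rw [he, norm_smul, norm_inv, norm_norm]
      exact inv_mul_le_one
    have hwe : inner ℝ w e = ‖w‖ := by
      rw [he, inner_smul_right, real_inner_self_eq_norm_sq]
      rcases eq_or_ne ‖w‖ 0 with h0 | h0
      · simp [h0]
      · field_simp
    set u' : Rn n := u + (r / 2) • e with hu'
    obtain ⟨hu'mem, hu'p⟩ := hball u' (by
      rw [mem_ball_iff_norm, hu', add_sub_cancel_left, norm_smul, Real.norm_eq_abs,
        abs_of_pos (half_pos hr)]
      nlinarith)
    have hu'dom : u' ∈ effDom φ := interior_subset hu'mem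
    have hz := hpconv.1 hx₀ hu'dom (sub_nonneg.2 (ht1 k)) (ht0 k).le (by ring)
    have hpz := hpconv.2 hx₀ hu'dom (sub_nonneg.2 (ht1 k)) (ht0 k).le (by ring)
    have hgrad := hφ.add_inner_grad_le hs (hxmem k) hz
    have hdiff : (1 - t k) • x₀ + t k • u' - x k = (t k * (r / 2)) • e := by
      simp only [hu', hxdef]; module
    have hxk : p x₀ ≤ p (x k) := hmin _ (interior_subset (hxmem k))
    have hsplit : inner ℝ v ((1 - t k) • x₀ + t k • u') =
        inner ℝ v (x k) + inner ℝ v ((t k * (r / 2)) • e) := by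
      rw [← hdiff, ← inner_add_right]; congr 1; abel
    have hgw : inner ℝ (grad φ (x k)) ((t k * (r / 2)) • e) =
        inner ℝ v ((t k * (r / 2)) • e) + t k * (r / 2) * ‖w‖ := by
      rw [← hwe, ← inner_smul_right w, ← inner_add_left, hw]; congr 1; abel
    rw [hdiff, hgw] at hgrad
    have hpz' : realValued φ ((1 - t k) • x₀ + t k • u')
        - inner ℝ v ((1 - t k) • x₀ + t k • u') ≤ (1 - t k) * p x₀ + t k * p u' := hpz
    have hpxk : p (x k) = realValued φ (x k) - inner ℝ v (x k) := rfl
    have h1 : t k * (r / 2 * ‖w‖) ≤ t k * (p u + 1 - p x₀) := by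
      nlinarith [mul_le_mul_of_nonneg_left hu'p.le (ht0 k).le]
    have h2 := le_of_mul_le_mul_left h1 (ht0 k)
    have h3 : ‖w‖ ≤ 2 * (p u + 1 - p x₀) / r := by
      rw [le_div_iff₀ hr]; linarith
    calc ‖grad φ (x k)‖ = ‖v + w‖ := by rw [hw, add_sub_cancel]
      _ ≤ ‖v‖ + ‖w‖ := norm_add_le _ _
      _ ≤ _ := by linarith
  obtain ⟨k, hk⟩ :=
    (hblow.eventually (eventually_gt_atTop (‖v‖ + 2 * (p u + 1 - p x₀) / r))).exists
  exact absurd (hbound k) (not_le.2 hk)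

/-- The gradient of a superlinear essentially smooth convex function is onto. -/
lemma IsGammaZero.exists_grad_eq {φ : Rn n → EReal} (hφ : IsGammaZero φ)
    (hs : EssentiallySmooth φ) (hc : SuperLinear φ) (v : Rn n) :
    ∃ w ∈ intDom φ, grad φ w = v := by
  obtain ⟨w, hw, hmin⟩ := hc.exists_forall_sub_inner_le hφ.1 hφ.2.1 v
  have hwint := hφ.mem_intDom_of_forall_sub_inner_le hs hw hmin
  refine ⟨w, hwint, ?_⟩
  have hloc : IsLocalMin (fun z => realValued φ z - inner ℝ v z) w := by
    filter_upwards [isOpen_interior.eventually_mem hwint] with z hz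
    exact hmin z (interior_subset hz)
  have hder := (hasGradientAt_realValued hs hwint).hasFDerivAt.sub
    (innerSL ℝ v).hasFDerivAt
  have h0 := hloc.hasFDerivAt_eq_zero hder
  have h1 : InnerProductSpace.toDual ℝ (Rn n) (grad φ w) = InnerProductSpace.toDual ℝ (Rn n) v :=
    sub_eq_zero.1 h0
  exact (InnerProductSpace.toDual ℝ (Rn n)).injective h1

/-! ### Adding the kernel -/

lemma addKernel_ne_bot {φ f : Rn n → EReal} {lam : ℝ} (hlam : 0 < lam) (hφ : ∀ x, φ x ≠ ⊥)
    (hf : ∀ x, f x ≠ ⊥) (x : Rn n) : addKernel φ f lam x ≠ ⊥ :=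
  EReal.add_ne_bot_iff.2 ⟨hf x, coe_mul_ne_bot (one_div_pos.2 hlam) (hφ x)⟩

lemma addKernel_eq_top {φ f : Rn n → EReal} {lam : ℝ} (hlam : 0 < lam) (hf : ∀ x, f x ≠ ⊥)
    {x : Rn n} (hx : φ x = ⊤) : addKernel φ f lam x = ⊤ := by
  rw [addKernel, hx, coe_mul_top (one_div_pos.2 hlam), EReal.add_top_of_ne_bot (hf x)]

lemma mem_effDom_of_addKernel_lt_top {φ f : Rn n → EReal} {lam : ℝ} (hlam : 0 < lam)
    (hφ : ∀ x, φ x ≠ ⊥) (hf : ∀ x, f x ≠ ⊥) {x : Rn n} (hx : addKernel φ f lam x < ⊤) :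
    x ∈ effDom f ∧ x ∈ effDom φ := by
  refine ⟨lt_top_iff_ne_top.2 fun (h : f x = ⊤) => hx.ne ?_,
    lt_top_iff_ne_top.2 fun (h : φ x = ⊤) => hx.ne (addKernel_eq_top hlam hf h)⟩
  rw [addKernel, h, EReal.top_add_of_ne_bot (coe_mul_ne_bot (one_div_pos.2 hlam) (hφ x))]

lemma addKernel_eq_coe {φ f : Rn n → EReal} {lam : ℝ} (hφ : IsProper φ) (hf : IsProper f)
    {x : Rn n} (hxf : x ∈ effDom f) (hxφ : x ∈ effDom φ) :
    addKernel φ f lam x = ((realValued f x + 1 / lam * realValued φ x : ℝ) : EReal) := by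
  rw [addKernel, hφ.coe_realValued hxφ, hf.coe_realValued hxf, EReal.coe_add, EReal.coe_mul]

lemma effDom_addKernel_nonempty {φ f : Rn n → EReal} {lam : ℝ} (hφ : IsProper φ)
    (hf : IsProper f) (h : (effDom f ∩ effDom φ).Nonempty) :
    (effDom (addKernel φ f lam)).Nonempty := by
  obtain ⟨z, hzf, hzφ⟩ := h
  refine ⟨z, ?_⟩
  rw [effDom, mem_ofPred_eq, addKernel_eq_coe hφ hf hzf hzφ]
  exact EReal.coe_lt_top _

lemma IsGammaZero.isGammaZero_addKernel {φ f : Rn n → EReal} {lam : ℝ} (hlam : 0 < lam)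
    (hφ : IsGammaZero φ) (hf : IsGammaZero f) (h : (effDom f ∩ effDom φ).Nonempty) :
    IsGammaZero (addKernel φ f lam) := by
  have hlam' := one_div_pos.2 hlam
  have hbot := addKernel_ne_bot hlam hφ.1.1 hf.1.1
  refine ⟨⟨hbot, effDom_addKernel_nonempty hφ.1 hf.1 h⟩, ?_, ?_⟩
  · exact hf.2.1.add' ((continuous_coe_mul hlam').comp_lowerSemicontinuous hφ.2.1
      (monotone_coe_mul hlam')) fun x => EReal.continuousAt_add
      (Or.inr (coe_mul_ne_bot hlam' (hφ.1.1 x))) (Or.inl (hf.1.1 x))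
  · rintro ⟨x, s⟩ hx ⟨y, t⟩ hy a b ha hb hab
    simp only [mem_ofPred_eq] at hx hy
    obtain ⟨hxf, hxφ⟩ := mem_effDom_of_addKernel_lt_top hlam hφ.1.1 hf.1.1
      (hx.trans_lt (EReal.coe_lt_top s))
    obtain ⟨hyf, hyφ⟩ := mem_effDom_of_addKernel_lt_top hlam hφ.1.1 hf.1.1
      (hy.trans_lt (EReal.coe_lt_top t))
    rw [addKernel_eq_coe hφ.1 hf.1 hxf hxφ, EReal.coe_le_coe_iff] at hx
    rw [addKernel_eq_coe hφ.1 hf.1 hyf hyφ, EReal.coe_le_coe_iff] at hy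
    have cf := hf.convexOn_realValued
    have cφ := hφ.convexOn_realValued
    have h1 := cf.2 hxf hyf ha hb hab
    have h2 := mul_le_mul_of_nonneg_left (cφ.2 hxφ hyφ ha hb hab) hlam'.le
    simp only [smul_eq_mul] at h1 h2
    change addKernel φ f lam (a • x + b • y) ≤ ((a * s + b * t : ℝ) : EReal)
    rw [addKernel_eq_coe hφ.1 hf.1 (cf.1 hxf hyf ha hb hab) (cφ.1 hxφ hyφ ha hb hab),
      EReal.coe_le_coe_iff]
    nlinarith [mul_le_mul_of_nonneg_left hx ha, mul_le_mul_of_nonneg_left hy hb]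

lemma bregDist_eq_coe {φ : Rn n → EReal} (hφ : IsProper φ) {x y : Rn n} (hx : x ∈ effDom φ)
    (hy : y ∈ intDom φ) :
    bregDist φ x y =
      ((realValued φ x - realValued φ y - inner ℝ (grad φ y) (x - y) : ℝ) : EReal) := by
  rw [bregDist, if_pos hy, hφ.coe_realValued hx, hφ.coe_realValued (interior_subset hy)]
  norm_cast

lemma bregDist_eq_top {φ : Rn n → EReal} (hφ : IsProper φ) {x y : Rn n} (hx : φ x = ⊤) :
    bregDist φ x y = ⊤ := by
  rw [bregDist]
  split_ifs with hy
  · rw [hx, hφ.coe_realValued (interior_subset hy), EReal.top_sub_coe, EReal.top_sub_coe]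
  · rfl

/-- Below the threshold of prox-boundedness, `f + (1 / lam) φ` is superlinear. -/
lemma superLinear_addKernel {φ f : Rn n → EReal} {lam : ℝ} (hlam : 0 < lam)
    (hφ : IsProper φ) (hφc : SuperLinear φ) (hf : IsProper f)
    (hlt : (lam : EReal) < proxThreshold φ f) : SuperLinear (addKernel φ f lam) := by
  obtain ⟨_, ⟨μ, ⟨hμ, y, hy, henv⟩, rfl⟩, hlamμ⟩ := lt_sSup_iff.1 hlt
  have hlamμ' : lam < μ := EReal.coe_lt_coe_iff.1 hlamμ
  obtain ⟨c, -, hc⟩ := EReal.lt_iff_exists_real_btwn.1 henv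
  -- The envelope bound at the larger parameter `μ` makes `f + φ / μ` bounded below by an affine
  -- function. The leftover `ε φ` supplies the superlinear growth.
  have hε : 0 < 1 / lam - 1 / μ := sub_pos.2 (one_div_lt_one_div_of_lt hlam hlamμ')
  set ε := 1 / lam - 1 / μ with hεdef
  intro M
  -- After multiplication by `ε`, this rate absorbs the affine part, of slope `∇φ(y) / μ`, and
  -- leaves `M`.
  obtain ⟨C, hC⟩ := hφc ((M + 1 / μ * ‖grad φ y‖) / ε)
  refine ⟨ε * C - c - 1 / μ * (realValued φ y - inner ℝ (grad φ y) y), fun x => ?_⟩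
  by_cases htop : addKernel φ f lam x < ⊤
  · obtain ⟨hxf, hxφ⟩ := mem_effDom_of_addKernel_lt_top hlam hφ.1 hf.1 htop
    have h1 := hc.le.trans (iInf_le _ x)
    rw [bregDist_eq_coe hφ hxφ hy, hf.coe_realValued hxf, ← EReal.coe_mul, ← EReal.coe_add,
      EReal.coe_le_coe_iff, inner_sub_right] at h1
    have h2 := hC x
    rw [hφ.coe_realValued hxφ, EReal.coe_le_coe_iff] at h2
    have h3 := mul_le_mul_of_nonneg_left h2 hε.le
    rw [mul_sub, ← mul_assoc, mul_div_cancel₀ _ hε.ne'] at h3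
    have h4 := mul_le_mul_of_nonneg_left (neg_le_of_abs_le (abs_real_inner_le_norm (grad φ y) x))
      (one_div_pos.2 hμ).le
    rw [addKernel_eq_coe hφ hf hxf hxφ, EReal.coe_le_coe_iff]
    have h5 : 1 / lam * realValued φ x = ε * realValued φ x + 1 / μ * realValued φ x := by
      rw [hεdef]; ring
    linarith
  · rw [not_lt_top_iff.1 htop]
    exact le_top

/-! ### The proximal hull -/

/-- On `dom φ`, the functions `c - (1 / lam) D_φ(·, w)` differ from affine functions by
`(1 / lam) φ`. -/
lemma coe_sub_bregDist {φ : Rn n → EReal} (hφ : IsProper φ) (lam c : ℝ) {x w : Rn n}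
    (hx : x ∈ effDom φ) (hw : w ∈ intDom φ) :
    (c : EReal) - ((1 / lam : ℝ) : EReal) * bregDist φ x w =
      ((inner ℝ ((1 / lam) • grad φ w) x
        - (inner ℝ ((1 / lam) • grad φ w) w - 1 / lam * realValued φ w - c)
        - 1 / lam * realValued φ x : ℝ) : EReal) := by
  rw [bregDist_eq_coe hφ hx hw]
  norm_cast
  rw [inner_sub_right, inner_smul_left, inner_smul_left]
  simp only [conj_trivial]
  ring

/-- On `dom φ`, moving `φ / lam` across the inequality turns it into an affine minorant condition.
Off `dom φ`, both conditions are vacuous. -/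
lemma forall_coe_sub_bregDist_le_iff {φ f : Rn n → EReal} {lam : ℝ} (hlam : 0 < lam)
    (hφ : IsProper φ) (hf : IsProper f) (c : ℝ) {w : Rn n} (hw : w ∈ intDom φ) :
    (∀ z, (c : EReal) - ((1 / lam : ℝ) : EReal) * bregDist φ z w ≤ f z) ↔
      fenchelConj (addKernel φ f lam) ((1 / lam) • grad φ w) ≤
        ((inner ℝ ((1 / lam) • grad φ w) w - 1 / lam * realValued φ w - c : ℝ) : EReal) := by
  rw [fenchelConj_le_coe_iff]
  refine forall_congr' fun z => ?_
  by_cases hz : z ∈ effDom φ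
  · rw [coe_sub_bregDist hφ lam c hz hw, addKernel, hφ.coe_realValued hz]
    induction h : f z with
    | bot => exact absurd h (hf.1 z)
    | coe r => norm_cast; exact sub_le_iff_le_add
    | top =>
      rw [← EReal.coe_mul, EReal.top_add_coe]
      simp
  · have hz' : φ z = ⊤ := not_lt_top_iff.1 hz
    rw [bregDist_eq_top hφ hz', coe_mul_top (one_div_pos.2 hlam), addKernel_eq_top hlam hf.1 hz']
    simp

/-- On `int dom φ`, the proximal hull of `f` is the biconjugate of `f + (1 / lam) φ` minus
`(1 / lam) φ`. -/
theorem proxHull_eq {φ f : Rn n → EReal} {lam : ℝ} (hlam : 0 < lam) (hφ : IsGammaZero φ)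
    (hs : EssentiallySmooth φ) (hc : SuperLinear φ) (hf : IsProper f) {G : Rn n → ℝ}
    (hG : ∀ y, fenchelConj (addKernel φ f lam) y = G y) {x : Rn n} (hx : x ∈ intDom φ) :
    proxHull φ f lam x =
      subTop (fenchelConj (fun y => (G y : EReal)) x) (((1 / lam : ℝ) : EReal) * φ x) := by
  have hxφ : x ∈ effDom φ := interior_subset hx
  rw [hφ.1.coe_realValued hxφ, ← EReal.coe_mul, subTop_coe]
  refine le_antisymm (sSup_le ?_) (EReal.sub_le_of_le_add (iSup_le fun v => ?_))
  · rintro _ ⟨c, w, hw, hcw, rfl⟩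
    rw [forall_coe_sub_bregDist_le_iff hlam hφ.1 hf c hw, hG, EReal.coe_le_coe_iff] at hcw
    rw [coe_sub_bregDist hφ.1 lam c hxφ hw, EReal.coe_sub]
    refine EReal.sub_le_sub ?_ le_rfl
    refine le_trans ?_ (le_fenchelConj_coe G x ((1 / lam) • grad φ w))
    rw [EReal.coe_le_coe_iff, real_inner_comm]
    linarith
  -- Surjectivity of the gradient realises an arbitrary slope `v`. The constant `c` is the largest
  -- admissible one: it makes the conjugate bound an equality.
  · obtain ⟨w, hw, hwv⟩ := hφ.exists_grad_eq hs hc (lam • v)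
    have hv : (1 / lam) • grad φ w = v := by
      rw [hwv, smul_smul, one_div_mul_cancel hlam.ne', one_smul]
    set c : ℝ := inner ℝ v w - 1 / lam * realValued φ w - G v with hcdef
    have hmem : (c : EReal) - ((1 / lam : ℝ) : EReal) * bregDist φ x w ≤ proxHull φ f lam x := by
      refine le_sSup ⟨c, w, hw, ?_, rfl⟩
      rw [forall_coe_sub_bregDist_le_iff hlam hφ.1 hf c hw, hv, hG, EReal.coe_le_coe_iff]
      linarith
    rw [coe_sub_bregDist hφ.1 lam c hxφ hw, hv] at hmem
    refine le_trans ?_ (add_le_add_left hmem _)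
    rw [real_inner_comm, ← EReal.coe_sub, ← EReal.coe_add, EReal.coe_le_coe_iff]
    linarith

/-- The proximal hull of a function in `Γ₀` agrees with it on `int dom φ`. -/
theorem IsGammaZero.proxHull_eq_self {φ f : Rn n → EReal} {lam : ℝ} (hlam : 0 < lam)
    (hφ : IsGammaZero φ) (hs : EssentiallySmooth φ) (hc : SuperLinear φ) (hf : IsGammaZero f)
    (hdom : (effDom f ∩ effDom φ).Nonempty) (hlt : (lam : EReal) < proxThreshold φ f)
    {x : Rn n} (hx : x ∈ intDom φ) : proxHull φ f lam x = f x := by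
  obtain ⟨G, hG⟩ := (superLinear_addKernel hlam hφ.1 hc hf.1 hlt).exists_fenchelConj_eq_coe
    (effDom_addKernel_nonempty hφ.1 hf.1 hdom)
  rw [proxHull_eq hlam hφ hs hc hf.1 hG hx, (hφ.isGammaZero_addKernel hlam hf hdom).fenchelConj_fenchelConj hG,
    addKernel, hφ.1.coe_realValued (interior_subset hx), ← EReal.coe_mul, subTop_coe,
    EReal.add_sub_cancel_right]

/-! ### Epi-convergence of the proximal average -/

theorem epiConvergesOn_proxAverage_zero {φ f₁ f₂ : Rn n → EReal} {lam : ℝ} (hlam : 0 < lam)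
    (hφ : IsGammaZero φ) (hs : EssentiallySmooth φ) (hc : SuperLinear φ)
    (hf₁ : IsProper f₁) (hf₂ : IsProper f₂)
    (hdom₁ : (effDom f₁ ∩ effDom φ).Nonempty) (hdom₂ : (effDom f₂ ∩ effDom φ).Nonempty)
    (hlt₁ : (lam : EReal) < proxThreshold φ f₁) (hlt₂ : (lam : EReal) < proxThreshold φ f₂) :
    EpiConvergesOn (proxAverage φ f₁ f₂ lam) (𝓝[>] (0 : ℝ)) (proxHull φ f₂ lam) (intDom φ) := by
  obtain ⟨G₁, hG₁⟩ := (superLinear_addKernel hlam hφ.1 hc hf₁ hlt₁).exists_fenchelConj_eq_coe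
    (effDom_addKernel_nonempty hφ.1 hf₁ hdom₁)
  obtain ⟨G₂, hG₂⟩ := (superLinear_addKernel hlam hφ.1 hc hf₂ hlt₂).exists_fenchelConj_eq_coe
    (effDom_addKernel_nonempty hφ.1 hf₂ hdom₂)
  intro a ha x hx
  -- The biconjugate of `f₁ + φ / lam` is finite at such a point, which anchors the recovery
  -- sequence.
  obtain ⟨z, hzf, hzφ⟩ := hdom₁
  have hz := fenchelConj_coe_le hG₁ z
  rw [addKernel_eq_coe hφ.1 hf₁ hzf hzφ] at hz
  have hev : ∀ᶠ z in 𝓝 x,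
      ((1 / lam : ℝ) : EReal) * φ z = ((1 / lam * realValued φ z : ℝ) : EReal) := by
    filter_upwards [isOpen_interior.eventually_mem hx] with z hz
    rw [hφ.1.coe_realValued (interior_subset hz), EReal.coe_mul]
  have hmain := (epiConvergesAt_fenchelConj_average G₁ G₂ hz ha x).subTop hev
    ((hs.2.1 x hx).continuousAt.const_mul (1 / lam))
  have hfun : (fun k => proxAverage φ f₁ f₂ lam (a k)) = fun k z => subTop
      (fenchelConj (fun y => ((a k * G₁ y + (1 - a k) * G₂ y : ℝ) : EReal)) z)
      (((1 / lam : ℝ) : EReal) * φ z) := by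
    funext k z
    simp only [proxAverage, hG₁, hG₂, EReal.coe_add, EReal.coe_mul]
  have hlim := proxHull_eq hlam hφ hs hc hf₂ hG₂ hx
  rw [hfun]
  unfold EpiConvergesAt
  rw [hlim]
  exact hmain

/-- This symmetry reduces the limit `α ↑ 1` to the limit `α ↓ 0`. -/
lemma proxAverage_comm (φ f₁ f₂ : Rn n → EReal) (lam α : ℝ) :
    proxAverage φ f₁ f₂ lam α = proxAverage φ f₂ f₁ lam (1 - α) := by
  funext x
  simp only [proxAverage, sub_sub_cancel, add_comm]

theorem epiConvergesOn_proxAverage_one {φ f₁ f₂ : Rn n → EReal} {lam : ℝ} (hlam : 0 < lam)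
    (hφ : IsGammaZero φ) (hs : EssentiallySmooth φ) (hc : SuperLinear φ)
    (hf₁ : IsProper f₁) (hf₂ : IsProper f₂)
    (hdom₁ : (effDom f₁ ∩ effDom φ).Nonempty) (hdom₂ : (effDom f₂ ∩ effDom φ).Nonempty)
    (hlt₁ : (lam : EReal) < proxThreshold φ f₁) (hlt₂ : (lam : EReal) < proxThreshold φ f₂) :
    EpiConvergesOn (proxAverage φ f₁ f₂ lam) (𝓝[<] (1 : ℝ)) (proxHull φ f₁ lam) (intDom φ) := by
  intro a ha x hx
  have ha' : Tendsto (fun k => 1 - a k) atTop (𝓝[>] 0) := by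
    rw [tendsto_nhdsWithin_iff] at ha ⊢
    refine ⟨by simpa using ha.1.const_sub 1, ha.2.mono fun k hk => ?_⟩
    exact sub_pos.2 (show a k < 1 from hk)
  simp only [proxAverage_comm φ f₁ f₂]
  exact epiConvergesOn_proxAverage_zero hlam hφ hs hc hf₂ hf₁ hdom₂ hdom₁ hlt₂ hlt₁ _ ha' x hx

lemma EpiConvergesOn.congr_right {F : ℝ → Rn n → EReal} {l : Filter ℝ} {f g : Rn n → EReal}
    {C : Set (Rn n)} (h : EpiConvergesOn F l f C) (hfg : ∀ x ∈ C, f x = g x) :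
    EpiConvergesOn F l g C := by
  intro a ha x hx
  have := h a ha x hx
  unfold EpiConvergesAt at this ⊢
  rwa [hfg x hx] at this

end BregmanAverage

end

theorem theorem6p2 {n : ℕ} (φ f₁ f₂ : BregmanAverage.Rn n → EReal) (lam : ℝ)
    (hφ_legendre : BregmanAverage.IsLegendre φ)
    (hφ_coercive : BregmanAverage.OneCoercive φ)
    (hφ_regular : BregmanAverage.IsRegularKernel φ)
    (hf₁_proper : BregmanAverage.IsProper f₁) (hf₁_lsc : LowerSemicontinuous f₁)
    (hf₁_prox : BregmanAverage.ProxBounded φ f₁)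
    (hf₂_proper : BregmanAverage.IsProper f₂) (hf₂_lsc : LowerSemicontinuous f₂)
    (hf₂_prox : BregmanAverage.ProxBounded φ f₂)
    (hdom₁ : (BregmanAverage.effDom f₁ ∩ BregmanAverage.effDom φ).Nonempty)
    (hdom₂ : (BregmanAverage.effDom f₂ ∩ BregmanAverage.effDom φ).Nonempty)
    (hlam_pos : 0 < lam)
    (hlam_lt : (lam : EReal) <
      min (BregmanAverage.proxThreshold φ f₁) (BregmanAverage.proxThreshold φ f₂)) :
    (BregmanAverage.EpiConvergesOn (BregmanAverage.proxAverage φ f₁ f₂ lam) (𝓝[>] (0 : ℝ))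
        (BregmanAverage.proxHull φ f₂ lam) (BregmanAverage.intDom φ) ∧
      BregmanAverage.EpiConvergesOn (BregmanAverage.proxAverage φ f₁ f₂ lam) (𝓝[<] (1 : ℝ))
        (BregmanAverage.proxHull φ f₁ lam) (BregmanAverage.intDom φ)) ∧
    (BregmanAverage.IsGammaZero f₁ → BregmanAverage.IsGammaZero f₂ →
      BregmanAverage.EpiConvergesOn (BregmanAverage.proxAverage φ f₁ f₂ lam) (𝓝[>] (0 : ℝ))
        f₂ (BregmanAverage.intDom φ) ∧
      BregmanAverage.EpiConvergesOn (BregmanAverage.proxAverage φ f₁ f₂ lam) (𝓝[<] (1 : ℝ))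
        f₁ (BregmanAverage.intDom φ)) := by
  obtain ⟨hlt₁, hlt₂⟩ := lt_min_iff.1 hlam_lt
  obtain ⟨hφ, hs, -⟩ := hφ_legendre
  have hc := hφ_coercive.superLinear hφ
  have h0 := BregmanAverage.epiConvergesOn_proxAverage_zero hlam_pos hφ hs hc hf₁_proper
    hf₂_proper hdom₁ hdom₂ hlt₁ hlt₂
  have h1 := BregmanAverage.epiConvergesOn_proxAverage_one hlam_pos hφ hs hc hf₁_proper
    hf₂_proper hdom₁ hdom₂ hlt₁ hlt₂
  exact ⟨⟨h0, h1⟩, fun hΓ₁ hΓ₂ =>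
    ⟨h0.congr_right fun x hx => hφ.proxHull_eq_self hlam_pos hs hc hΓ₂ hdom₂ hlt₂ hx,
      h1.congr_right fun x hx => hφ.proxHull_eq_self hlam_pos hs hc hΓ₁ hdom₁ hlt₁ hx⟩⟩
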